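/- For $k\ge 0$ let $(a;q)_k=\prod_{j=0}^{k-1}(1-aq^j)$, let $[m]=\frac{1-q^m}{1-q}=1+q+\dots+q^{m-1}$, let $\Phi_n(q)\in\mathbb Z[q]$ be the $n$-th cyclotomic polynomial, and let $\left(\frac{-3}{n}\right)$ be the Jacobi--Kronecker symbol. For rational functions $A,B\in\mathbb Z(q)$ and a polynomial $P\in\mathbb Z[q]$, write $A\equiv B\pmod{P}$ if $A-B=A_1/A_2$ for some $A_1,A_2\in\mathbb Z[q]$, $A_2\ne0$, such that $P$ divides $A_1$ and $P$ and $A_2$ have no non-unit common factor in $\mathbb Z[q]$. Let $n$ be a positive integer coprime with $6$. Then $$ \sum_{k=0}^{n-1}\frac{(q;q^2)_k^2\,(q;q^2)_{2k}}{(q^2;q^2)_{2k}\,(q^6;q^6)_k^2}\,[8k+1]\,q^{2k^2} \equiv q^{-(n-1)/2}\,[n]\left(\frac{-3}{n}\right)\pmod{[n]\,\Phi_n(q)^2}. $$ -/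

import Mathlib

open Polynomial

/-- The `q`-Pochhammer symbol `(a; q)_k = ∏_{j=0}^{k-1} (1 - a q^j)`. -/
def qPoch {R : Type*} [CommRing R] (a q : R) (k : ℕ) : R :=
  ∏ j ∈ Finset.range k, (1 - a * q ^ j)

/-- The `q`-number `[m]_q = 1 + q + ⋯ + q^{m-1}`. -/
def qNumber {R : Type*} [CommRing R] (q : R) (m : ℕ) : R :=
  ∑ j ∈ Finset.range m, q ^ j

/-- `[m]_q = (1 - q^m) / (1 - q)`. -/
theorem qNumber_eq_div {F : Type*} [Field F] {q : F} (hq : q ≠ 1) (m : ℕ) :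
    qNumber q m = (1 - q ^ m) / (1 - q) := by
  rw [qNumber, geom_sum_eq hq, ← neg_div_neg_eq, neg_sub, neg_sub]

/-- Congruence of rational functions `A, B ∈ ℤ(q)` modulo a polynomial `P ∈ ℤ[q]`:
the difference `A - B` can be written as a fraction `A₁ / A₂` of integer polynomials
such that `P` divides `A₁` and `P` has no nontrivial common factor with `A₂`. -/
def RatCongr (P : ℤ[X]) (A B : RatFunc ℤ) : Prop :=
  ∃ A₁ A₂ : ℤ[X], A₂ ≠ 0 ∧
    A - B = algebraMap ℤ[X] (RatFunc ℤ) A₁ / algebraMap ℤ[X] (RatFunc ℤ) A₂ ∧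
    P ∣ A₁ ∧ IsRelPrime P A₂

/-- The `k`-th term
`(q;q²)_k² (q;q²)_{2k} / ((q²;q²)_{2k} (q⁶;q⁶)_k²) · [8k+1] q^{2k²}`. -/
noncomputable def qTerm {F : Type*} [Field F] (q : F) (k : ℕ) : F :=
  qPoch q (q ^ 2) k ^ 2 * qPoch q (q ^ 2) (2 * k) /
      (qPoch (q ^ 2) (q ^ 2) (2 * k) * qPoch (q ^ 6) (q ^ 6) k ^ 2) *
    qNumber q (8 * k + 1) * q ^ (2 * k ^ 2)

section WZ

variable {K : Type*} [Field K]

/-- The factor of the parametric summand that depends on the parameter `a`: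
`(aq;q²)_k (q/a;q²)_k / ((aq⁶;q⁶)_k (q⁶/a;q⁶)_k)`. -/
noncomputable def paramRatio (q a : K) (k : ℕ) : K :=
  ∏ j ∈ Finset.range k, ((1 - a * q ^ (2 * j + 1)) * (a - q ^ (2 * j + 1))) /
    ((1 - a * q ^ (6 * j + 6)) * (a - q ^ (6 * j + 6)))

/-- The parametric summand, with `β` in the role of `(q;q²)_m / (q²;q²)_m`
and without the denominator `1 - q`. -/
noncomputable def paramTerm (q a : K) (β : ℕ → K) (k : ℕ) : K :=
  paramRatio q a k * (β (2 * k) * (1 - q ^ (8 * k + 1)) * q ^ (2 * k ^ 2))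

/-- The certificate of the telescoping relation, up to simple factors. -/
noncomputable def wzCertificate (q a : K) (β : ℕ → K) (k : ℕ) : K :=
  (1 - a ^ 2 * q ^ 6) * (1 - a * q ^ 6) * (a - q ^ (6 * k)) * (1 - q ^ (4 * k)) *
    (q ^ 2 - q ^ (4 * k)) *
    (∏ j ∈ Finset.range k, ((1 - a * q ^ (2 * j + 1)) * (a * q ^ 6 - q ^ (2 * j + 1))) /
      ((1 - a * q ^ (6 * j + 6)) * (a - q ^ (6 * j + 6)))) / q ^ (6 * k) *
    (β (2 * k) * q ^ (2 * k ^ 2))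

theorem prod_shift_num (q a : K) (k : ℕ) :
    (∏ j ∈ Finset.range k, (1 - a * q ^ 6 * q ^ (2 * j + 1))) *
      ((1 - a * q) * (1 - a * q ^ 3) * (1 - a * q ^ 5)) =
    (∏ j ∈ Finset.range k, (1 - a * q ^ (2 * j + 1))) *
      ((1 - a * q ^ (2 * k + 1)) * (1 - a * q ^ (2 * k + 3)) * (1 - a * q ^ (2 * k + 5))) := by
  induction k with
  | zero => simp
  | succ k ih =>
    rw [Finset.prod_range_succ, Finset.prod_range_succ]
    linear_combination (1 - a * q ^ 6 * q ^ (2 * k + 1)) * ih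

theorem prod_shift_num' (q a : K) (k : ℕ) :
    (∏ j ∈ Finset.range k, (a * q ^ 6 - q ^ (2 * j + 1))) *
      ((a * q ^ 5 - q ^ (2 * k)) * (a * q ^ 5 - q ^ (2 * k + 2)) * (a * q ^ 5 - q ^ (2 * k + 4))) =
    -(q ^ (6 * k + 6) * (∏ j ∈ Finset.range k, (a - q ^ (2 * j + 1))) *
      ((1 - a * q) * (1 - a * q ^ 3) * (1 - a * q ^ 5))) := by
  induction k with
  | zero => simp; ring
  | succ k ih =>
    rw [Finset.prod_range_succ, Finset.prod_range_succ]
    have h1 : a * q ^ 6 - q ^ (2 * k + 1) = q * (a * q ^ 5 - q ^ (2 * k)) := by ring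
    have h2 : a * q ^ 5 - q ^ (2 * (k + 1) + 4) = q ^ 5 * (a - q ^ (2 * k + 1)) := by ring
    have h3 : 2 * (k + 1) = 2 * k + 2 := by ring
    have h4 : 2 * (k + 1) + 2 = 2 * k + 4 := by ring
    rw [h1, h2, h4, h3]
    linear_combination q ^ 6 * (a - q ^ (2 * k + 1)) * ih

theorem prod_shift_den (q a : K) (k : ℕ) :
    (∏ j ∈ Finset.range k, (1 - a * q ^ 6 * q ^ (6 * j + 6))) * (1 - a * q ^ 6) =
    (∏ j ∈ Finset.range k, (1 - a * q ^ (6 * j + 6))) * (1 - a * q ^ (6 * k + 6)) := by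
  induction k with
  | zero => simp
  | succ k ih =>
    rw [Finset.prod_range_succ, Finset.prod_range_succ]
    linear_combination (1 - a * q ^ 6 * q ^ (6 * k + 6)) * ih

theorem prod_shift_den' (q a : K) (k : ℕ) :
    (∏ j ∈ Finset.range k, (a * q ^ 6 - q ^ (6 * j + 6))) * (a - q ^ (6 * k)) =
    q ^ (6 * k) * (a - 1) * (∏ j ∈ Finset.range k, (a - q ^ (6 * j + 6))) := by
  induction k with
  | zero => simp
  | succ k ih =>
    rw [Finset.prod_range_succ, Finset.prod_range_succ]
    linear_combination q ^ 6 * (a - q ^ (6 * k + 6)) * ih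

/-- The common part of `paramTerm q a`, `paramTerm q (a * q ^ 6)` and `wzCertificate q a`. -/
noncomputable def wzKernel (q a : K) (k : ℕ) : K :=
  ∏ j ∈ Finset.range k, ((1 - a * q ^ (2 * j + 1)) * (a * q ^ 6 - q ^ (2 * j + 1))) /
      ((1 - a * q ^ (6 * j + 6)) * (a - q ^ (6 * j + 6)))

theorem paramRatio_mul_eq {q a : K} (hq : q ≠ 0) (k : ℕ) :
    (1 - a * q) * (1 - a * q ^ 3) * (1 - a * q ^ 5) * paramRatio q a k =
      -(wzKernel q a k * ((a * q ^ 5 - q ^ (2 * k)) * (a * q ^ 5 - q ^ (2 * k + 2)) *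
        (a * q ^ 5 - q ^ (2 * k + 4))) / q ^ (6 * k + 6)) := by
  have h := prod_shift_num' q a k
  have hq' : q ^ (6 * k + 6) ≠ 0 := pow_ne_zero _ hq
  simp only [paramRatio, wzKernel, Finset.prod_div_distrib, Finset.prod_mul_distrib]
  generalize (∏ j ∈ Finset.range k, (1 - a * q ^ (2 * j + 1))) = A at *
  generalize (∏ j ∈ Finset.range k, (a - q ^ (2 * j + 1))) = B at *
  generalize (∏ j ∈ Finset.range k, (a * q ^ 6 - q ^ (2 * j + 1))) = B' at *
  generalize ((∏ j ∈ Finset.range k, (1 - a * q ^ (6 * j + 6))) *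
    ∏ j ∈ Finset.range k, (a - q ^ (6 * j + 6))) = D
  have key := eq_div_of_mul_eq hq' ((by linear_combination h :
    (B * ((1 - a * q) * (1 - a * q ^ 3) * (1 - a * q ^ 5))) * q ^ (6 * k + 6) =
    -(B' * ((a * q ^ 5 - q ^ (2 * k)) * (a * q ^ 5 - q ^ (2 * k + 2)) *
      (a * q ^ 5 - q ^ (2 * k + 4))))))
  linear_combination (A * D⁻¹) * key

theorem paramRatio_shift_mul_eq {q a : K} (hq : q ≠ 0) (h0 : a - 1 ≠ 0)
    (h1 : ∀ j, 1 - a * q ^ (6 * j + 6) ≠ 0) (h2 : ∀ j, a - q ^ (6 * j) ≠ 0) (k : ℕ) :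
    (1 - a * q) * (1 - a * q ^ 3) * (1 - a * q ^ 5) * paramRatio q (a * q ^ 6) k =
      wzKernel q a k * ((1 - a * q ^ (2 * k + 1)) * (1 - a * q ^ (2 * k + 3)) *
        (1 - a * q ^ (2 * k + 5))) * ((1 - a * q ^ 6) * (a - q ^ (6 * k))) /
        ((1 - a * q ^ (6 * k + 6)) * q ^ (6 * k) * (a - 1)) := by
  have e1 := prod_shift_num q a k
  have e2 := prod_shift_den q a k
  have e3 := prod_shift_den' q a k
  have n1 : ∏ j ∈ Finset.range k, (1 - a * q ^ (6 * j + 6)) ≠ 0 :=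
    Finset.prod_ne_zero_iff.2 fun j _ => h1 j
  have n2 : ∏ j ∈ Finset.range k, (a - q ^ (6 * j + 6)) ≠ 0 :=
    Finset.prod_ne_zero_iff.2 fun j _ => h2 (j + 1)
  have n3 := h1 0
  have n4 := h1 k
  have n5 := h2 k
  have n6 : q ^ (6 * k) ≠ 0 := pow_ne_zero _ hq
  simp only [mul_zero, zero_add] at n3
  rw [paramRatio, wzKernel, Finset.prod_div_distrib,
    Finset.prod_div_distrib, Finset.prod_mul_distrib, Finset.prod_mul_distrib,
    Finset.prod_mul_distrib, Finset.prod_mul_distrib,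
    eq_div_of_mul_eq n3 e2, eq_div_of_mul_eq n5 e3]
  generalize (∏ j ∈ Finset.range k, (1 - a * q ^ (6 * j + 6))) = D at *
  generalize (∏ j ∈ Finset.range k, (a - q ^ (6 * j + 6))) = D' at *
  generalize (∏ j ∈ Finset.range k, (1 - a * q ^ (2 * j + 1))) = A at *
  generalize (∏ j ∈ Finset.range k, (1 - a * q ^ 6 * q ^ (2 * j + 1))) = A' at *
  generalize (∏ j ∈ Finset.range k, (a * q ^ 6 - q ^ (2 * j + 1))) = B' at *
  generalize q ^ (6 * k) = x at *
  generalize 1 - a * q ^ (6 * k + 6) = y at *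
  generalize 1 - a * q ^ 6 = u at *
  generalize a - x = v at *
  generalize a - 1 = w at *
  field_simp
  linear_combination B' * e1

theorem wz_step {q a : K} {β : ℕ → K} (hq : q ≠ 0)
    (hβ : ∀ m, β (m + 1) * (1 - q ^ (2 * m + 2)) = β m * (1 - q ^ (2 * m + 1)))
    (h1 : ∀ j, 1 - a * q ^ (6 * j + 6) ≠ 0) (h2 : ∀ j, a - q ^ (6 * j) ≠ 0) (k : ℕ) :
    (1 - a * q) * (1 - a * q ^ 3) * (1 - a * q ^ 5) *
      (paramTerm q (a * q ^ 6) β k * (q ^ 3 * (1 - a)) - paramTerm q a β k * (1 - a * q ^ 6)) =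
    q * (wzCertificate q a β (k + 1) - wzCertificate q a β k) := by
  have h0 : a - 1 ≠ 0 := by simpa using h2 0
  have e1 := paramRatio_mul_eq (a := a) hq k
  have e2 := paramRatio_shift_mul_eq hq h0 h1 h2 k
  have e3 : β (2 * (k + 1)) * ((1 - q ^ (4 * k + 4)) * (q ^ 2 - q ^ (4 * k + 4))) =
      q ^ 2 * (β (2 * k) * ((1 - q ^ (4 * k + 1)) * (1 - q ^ (4 * k + 3)))) := by
    have i1 := hβ (2 * k)
    have i2 := hβ (2 * k + 1)
    rw [show 2 * (k + 1) = 2 * k + 1 + 1 by ring]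
    rw [show 2 * (2 * k + 1) + 2 = 4 * k + 4 by ring,
      show 2 * (2 * k + 1) + 1 = 4 * k + 3 by ring] at i2
    rw [show 2 * (2 * k) + 2 = 4 * k + 2 by ring,
      show 2 * (2 * k) + 1 = 4 * k + 1 by ring] at i1
    linear_combination (q ^ 2 - q ^ (4 * k + 4)) * i2 + q ^ 2 * (1 - q ^ (4 * k + 3)) * i1
  have n4 := h1 k
  have n5 := h2 (k + 1)
  have hk : wzKernel q a (k + 1) = wzKernel q a k *
      (((1 - a * q ^ (2 * k + 1)) * (a * q ^ 6 - q ^ (2 * k + 1))) /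
      ((1 - a * q ^ (6 * k + 6)) * (a - q ^ (6 * k + 6)))) := Finset.prod_range_succ _ _
  have l : (1 - a * q) * (1 - a * q ^ 3) * (1 - a * q ^ 5) *
      (paramTerm q (a * q ^ 6) β k * (q ^ 3 * (1 - a)) - paramTerm q a β k * (1 - a * q ^ 6)) =
      ((1 - a * q) * (1 - a * q ^ 3) * (1 - a * q ^ 5) * paramRatio q (a * q ^ 6) k *
        (q ^ 3 * (1 - a)) - (1 - a * q) * (1 - a * q ^ 3) * (1 - a * q ^ 5) * paramRatio q a k *
        (1 - a * q ^ 6)) * (β (2 * k) * (1 - q ^ (8 * k + 1)) * q ^ (2 * k ^ 2)) := by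
    simp only [paramTerm]; ring
  have hc : wzCertificate q a β (k + 1) = (1 - a ^ 2 * q ^ 6) * (1 - a * q ^ 6) *
      (a - q ^ (6 * (k + 1))) * wzKernel q a (k + 1) / q ^ (6 * (k + 1)) *
      q ^ (2 * (k + 1) ^ 2) *
      (β (2 * (k + 1)) * ((1 - q ^ (4 * k + 4)) * (q ^ 2 - q ^ (4 * k + 4)))) := by
    simp only [wzCertificate, wzKernel, mul_add, mul_one]; ring
  rw [l, e1, e2, hc, e3, hk, wzCertificate, ← wzKernel]
  have p : q ^ (2 * (k + 1) ^ 2) = q ^ (2 * k ^ 2) * (q ^ k) ^ 4 * q ^ 2 := by ring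
  rw [p]
  have hx : q ^ k ≠ 0 := pow_ne_zero _ hq
  simp only [pow_add, pow_mul', mul_add, mul_one] at *
  clear hc l
  generalize β (2 * k) = b at *
  generalize wzKernel q a k = m at *
  generalize q ^ (2 * k ^ 2) = s at *
  generalize q ^ k = x at *
  obtain ⟨y, hy⟩ : ∃ y, y = 1 - a * (x ^ 6 * q ^ 6) := ⟨_, rfl⟩
  obtain ⟨w, hw⟩ : ∃ w, w = a - x ^ 6 * q ^ 6 := ⟨_, rfl⟩
  obtain ⟨c, hc⟩ : ∃ c, c = a - 1 := ⟨_, rfl⟩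
  rw [← hy] at n4 ⊢
  rw [← hw] at n5 ⊢
  rw [← hc] at h0 ⊢
  rw [show 1 - a = -c by rw [hc]; ring]
  clear e1 e2 e3 p hk h1 h2 hβ
  field_simp
  rw [hy]
  ring

end WZ

section TerminatingSum

variable {K : Type*} [Field K]

theorem wz_sum {q a : K} {β : ℕ → K} (hq : q ≠ 0)
    (hβ : ∀ m, β (m + 1) * (1 - q ^ (2 * m + 2)) = β m * (1 - q ^ (2 * m + 1)))
    (h1 : ∀ j, 1 - a * q ^ (6 * j + 6) ≠ 0) (h2 : ∀ j, a - q ^ (6 * j) ≠ 0) (M : ℕ) :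
    (1 - a * q) * (1 - a * q ^ 3) * (1 - a * q ^ 5) *
      ((∑ k ∈ Finset.range M, paramTerm q (a * q ^ 6) β k) * (q ^ 3 * (1 - a)) -
        (∑ k ∈ Finset.range M, paramTerm q a β k) * (1 - a * q ^ 6)) =
    q * wzCertificate q a β M := by
  have h0 : wzCertificate q a β 0 = 0 := by simp [wzCertificate]
  rw [Finset.sum_mul, Finset.sum_mul, ← Finset.sum_sub_distrib, Finset.mul_sum,
    Finset.sum_congr rfl fun k _ => wz_step hq hβ h1 h2 k, ← Finset.mul_sum,
    Finset.sum_range_sub, h0, sub_zero]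

/-- If the telescoped boundary term vanishes, the parametric sums at `a` and `a q⁶` are
proportional. -/
theorem sum_paramTerm_shift {q a : K} {β : ℕ → K} (hq : q ≠ 0)
    (hβ : ∀ m, β (m + 1) * (1 - q ^ (2 * m + 2)) = β m * (1 - q ^ (2 * m + 1)))
    (h1 : ∀ j, 1 - a * q ^ (6 * j + 6) ≠ 0) (h2 : ∀ j, a - q ^ (6 * j) ≠ 0)
    (h3 : (1 - a * q) * (1 - a * q ^ 3) * (1 - a * q ^ 5) ≠ 0) {M : ℕ}
    (hM : wzCertificate q a β M = 0) :
    (∑ k ∈ Finset.range M, paramTerm q (a * q ^ 6) β k) * (q ^ 3 * (1 - a)) =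
      (∑ k ∈ Finset.range M, paramTerm q a β k) * (1 - a * q ^ 6) := by
  have h := wz_sum hq hβ h1 h2 M
  rw [hM, mul_zero, mul_eq_zero, or_iff_right h3, sub_eq_zero] at h
  exact h

/-- `(q;q²)_m / (q²;q²)_m`. -/
noncomputable def pochRatio (q : K) (m : ℕ) : K :=
  ∏ j ∈ Finset.range m, (1 - q ^ (2 * j + 1)) / (1 - q ^ (2 * j + 2))

theorem pochRatio_succ {q : K} (hq1 : ∀ i, 0 < i → q ^ i ≠ 1) (m : ℕ) :
    pochRatio q (m + 1) * (1 - q ^ (2 * m + 2)) = pochRatio q m * (1 - q ^ (2 * m + 1)) := by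
  rw [pochRatio, Finset.prod_range_succ, mul_assoc, div_mul_cancel₀, ← pochRatio]
  exact sub_ne_zero.2 (hq1 _ (by omega)).symm

theorem pow_injective_of_not_root {q : K} (hq : q ≠ 0) (hq1 : ∀ i, 0 < i → q ^ i ≠ 1) {i j : ℕ}
    (h : q ^ i = q ^ j) : i = j := by
  wlog hij : i ≤ j generalizing i j
  · exact (this h.symm (by omega)).symm
  by_contra hne
  obtain ⟨d, rfl⟩ := Nat.exists_eq_add_of_le hij
  refine hq1 d (by omega) ?_
  rw [pow_add] at h
  exact (mul_left_cancel₀ (pow_ne_zero i hq) (by rw [mul_one]; exact h)).symm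

theorem paramTerm_eq_zero {q : K} {β : ℕ → K} {h k : ℕ} (hk : h < k) :
    paramTerm q (q ^ (2 * h + 1)) β k = 0 := by
  rw [paramTerm, paramRatio, Finset.prod_eq_zero (Finset.mem_range.2 hk), zero_mul]
  simp

theorem sum_paramTerm_pow_shift {q : K} (hq : q ≠ 0) (hq1 : ∀ i, 0 < i → q ^ i ≠ 1)
    {h M : ℕ} (hM : h + 4 ≤ M) :
    (∑ k ∈ Finset.range M, paramTerm q (q ^ (2 * h + 7)) (pochRatio q) k) *
        (q ^ 3 * (1 - q ^ (2 * h + 1))) =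
      (∑ k ∈ Finset.range M, paramTerm q (q ^ (2 * h + 1)) (pochRatio q) k) *
        (1 - q ^ (2 * h + 7)) := by
  have e : q ^ (2 * h + 7) = q ^ (2 * h + 1) * q ^ 6 := by rw [← pow_add]
  rw [e]
  have ne : ∀ i, 0 < i → 1 - q ^ i ≠ 0 := fun i hi => sub_ne_zero.2 (hq1 i hi).symm
  refine sum_paramTerm_shift hq (pochRatio_succ hq1) ?_ ?_ ?_ ?_
  · intro j
    rw [← pow_add]
    exact ne _ (by omega)
  · intro j h0
    have := pow_injective_of_not_root hq hq1 (sub_eq_zero.1 h0)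
    omega
  · rw [← pow_succ, ← pow_add, ← pow_add]
    exact mul_ne_zero (mul_ne_zero (ne _ (by omega)) (ne _ (by omega))) (ne _ (by omega))
  · rw [wzCertificate, Finset.prod_eq_zero (i := h + 3) (Finset.mem_range.2 (by omega))]
    · simp
    · rw [show 2 * (h + 3) + 1 = 2 * h + 1 + 6 by ring, ← pow_add _ (2 * h + 1) 6, sub_self]
      simp

theorem sum_paramTerm_pow_one {q : K} (hq : q ≠ 0) (hq1 : ∀ i, 0 < i → q ^ i ≠ 1) (i : ℕ) :
    ∀ M, 3 * i + 1 ≤ M →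
      (∑ k ∈ Finset.range M, paramTerm q (q ^ (2 * (3 * i) + 1)) (pochRatio q) k) * q ^ (3 * i) =
        1 - q ^ (2 * (3 * i) + 1) := by
  induction i with
  | zero =>
    intro M hM
    rw [← Finset.sum_subset (Finset.range_subset_range.2 hM)]
    · simp [paramTerm, paramRatio, pochRatio]
    · intro k _ hk
      exact paramTerm_eq_zero (by rw [Finset.mem_range] at hk; omega)
  | succ i ih =>
    intro M hM
    have h := sum_paramTerm_pow_shift hq hq1 (h := 3 * i) (M := M) (by omega)
    rw [show 2 * (3 * (i + 1)) + 1 = 2 * (3 * i) + 7 by ring]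
    have n : 1 - q ^ (2 * (3 * i) + 1) ≠ 0 := sub_ne_zero.2 (hq1 _ (by omega)).symm
    refine mul_right_cancel₀ n ?_
    have := ih M (by omega)
    rw [show 3 * (i + 1) = 3 * i + 3 by ring, pow_add q (3 * i) 3]
    linear_combination q ^ (3 * i) * h + (1 - q ^ (2 * (3 * i) + 7)) * this

theorem sum_paramTerm_pow_five {q : K} (hq : q ≠ 0) (hq1 : ∀ i, 0 < i → q ^ i ≠ 1) (i : ℕ) :
    ∀ M, 3 * i + 3 ≤ M →
      (∑ k ∈ Finset.range M, paramTerm q (q ^ (2 * (3 * i + 2) + 1)) (pochRatio q) k) *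
        q ^ (3 * i + 2) = -(1 - q ^ (2 * (3 * i + 2) + 1)) := by
  induction i with
  | zero =>
    intro M hM
    rw [← Finset.sum_subset (Finset.range_subset_range.2 hM)]
    · have ne : ∀ i, 0 < i → 1 - q ^ i ≠ 0 := fun i hi => sub_ne_zero.2 (hq1 i hi).symm
      have n1 : 1 - q ≠ 0 := by simpa using ne 1 (by omega)
      have n2 := ne 2 (by omega)
      have n4 := ne 4 (by omega)
      have n6 := ne 6 (by omega)
      have n7 := ne 7 (by omega)
      have n8 := ne 8 (by omega)
      have n11 := ne 11 (by omega)
      have n17 := ne 17 (by omega)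
      have d1 : q ^ 5 - q ^ 6 = q ^ 5 * (1 - q) := by ring
      have d2 : q ^ 5 - q ^ 12 = q ^ 5 * (1 - q ^ 7) := by ring
      have m1 : 1 - q ^ 5 * q ^ 6 = 1 - q ^ 11 := by ring
      have m2 : 1 - q ^ 5 * q ^ 12 = 1 - q ^ 17 := by ring
      simp only [Finset.sum_range_succ, Finset.prod_range_succ, paramTerm, paramRatio, pochRatio,
        Finset.sum_range_zero, Finset.prod_range_zero, mul_zero, zero_add, mul_one, one_mul,
        Nat.reduceMul, Nat.reduceAdd, Nat.reducePow, pow_one, d1, d2, m1, m2]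
      field_simp
      ring
    · intro k _ hk
      exact paramTerm_eq_zero (by rw [Finset.mem_range] at hk; omega)
  | succ i ih =>
    intro M hM
    have h := sum_paramTerm_pow_shift hq hq1 (h := 3 * i + 2) (M := M) (by omega)
    rw [show 2 * (3 * (i + 1) + 2) + 1 = 2 * (3 * i + 2) + 7 by ring]
    have n : 1 - q ^ (2 * (3 * i + 2) + 1) ≠ 0 := sub_ne_zero.2 (hq1 _ (by omega)).symm
    refine mul_right_cancel₀ n ?_
    have := ih M (by omega)
    rw [show 3 * (i + 1) + 2 = 3 * i + 2 + 3 by ring, pow_add q (3 * i + 2) 3]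
    linear_combination q ^ (3 * i + 2) * h + (1 - q ^ (2 * (3 * i + 2) + 7)) * this

theorem jacobiSym_neg_three_eq {n : ℕ} (hn : n.Coprime 6) :
    jacobiSym (-3) n = if n % 6 = 1 then 1 else -1 := by
  have h2 : ¬ 2 ∣ n := fun h => by
    have := Nat.dvd_gcd h (by norm_num : 2 ∣ 6); rw [hn] at this; omega
  have h3 : ¬ 3 ∣ n := fun h => by
    have := Nat.dvd_gcd h (by norm_num : 3 ∣ 6); rw [hn] at this; omega
  rw [jacobiSym.mod_right (-3) (Nat.odd_iff.2 (by omega))]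
  have : n % 12 = 1 ∨ n % 12 = 5 ∨ n % 12 = 7 ∨ n % 12 = 11 := by omega
  have e : 4 * (-3 : ℤ).natAbs = 12 := rfl
  rw [e]
  rcases this with h | h | h | h <;> rw [h]
  · rw [if_pos (by omega)]; norm_num
  · rw [if_neg (by omega)]; norm_num
  · rw [if_pos (by omega)]; norm_num
  · rw [if_neg (by omega)]; norm_num

theorem sum_paramTerm_pow {q : K} (hq : q ≠ 0) (hq1 : ∀ i, 0 < i → q ^ i ≠ 1) {h M : ℕ}
    (hh : (2 * h + 1).Coprime 6) (hM : h + 1 ≤ M) :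
    (∑ k ∈ Finset.range M, paramTerm q (q ^ (2 * h + 1)) (pochRatio q) k) * q ^ h =
      (1 - q ^ (2 * h + 1)) * (jacobiSym (-3) (2 * h + 1) : ℤ) := by
  have h3 : ¬ 3 ∣ 2 * h + 1 := fun h => by
    have := Nat.dvd_gcd h (by norm_num : 3 ∣ 6); rw [hh] at this; omega
  rw [jacobiSym_neg_three_eq hh]
  have : h % 3 = 0 ∨ h % 3 = 2 := by omega
  rcases this with h' | h'
  · obtain ⟨i, rfl⟩ := Nat.dvd_of_mod_eq_zero h'
    rw [if_pos (by omega), sum_paramTerm_pow_one hq hq1 i M hM]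
    simp
  · obtain ⟨i, rfl⟩ : ∃ i, h = 3 * i + 2 := ⟨h / 3, by omega⟩
    rw [if_neg (by omega), sum_paramTerm_pow_five hq hq1 i M hM]
    simp

end TerminatingSum

section Cleared

variable {R : Type*} [CommRing R]

/-- The parametric ratio `paramRatio q a k`, multiplied by the common denominator
`∏_{j<L} (1 - a q^{6j+6}) (a - q^{6j+6})`. -/
def clearedFactor (q a : R) (L k : ℕ) : R :=
  (∏ j ∈ Finset.range k, ((1 - a * q ^ (2 * j + 1)) * (a - q ^ (2 * j + 1)))) *
    ∏ j ∈ Finset.Ico k L, ((1 - a * q ^ (6 * j + 6)) * (a - q ^ (6 * j + 6)))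

/-- The common denominator of the parametric summands. -/
def commonDenom (q a : R) (L : ℕ) : R :=
  ∏ j ∈ Finset.range L, ((1 - a * q ^ (6 * j + 6)) * (a - q ^ (6 * j + 6)))

/-- The parametric sum, multiplied by the common denominator of its summands. -/
def clearedSum (q a : R) (β : ℕ → R) (n : ℕ) : R :=
  ∑ k ∈ Finset.range n, clearedFactor q a (n - 1) k *
    (β (2 * k) * (1 - q ^ (8 * k + 1)) * q ^ (2 * k ^ 2))

theorem map_clearedFactor {S : Type*} [CommRing S] (f : R →+* S) (q a : R) (L k : ℕ) :
    f (clearedFactor q a L k) = clearedFactor (f q) (f a) L k := by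
  simp [clearedFactor, map_prod]

theorem map_commonDenom {S : Type*} [CommRing S] (f : R →+* S) (q a : R) (L : ℕ) :
    f (commonDenom q a L) = commonDenom (f q) (f a) L := by
  simp [commonDenom, map_prod]

theorem map_clearedSum {S : Type*} [CommRing S] (f : R →+* S) (q a : R) (β : ℕ → R) (n : ℕ) :
    f (clearedSum q a β n) = clearedSum (f q) (f a) (f ∘ β) n := by
  simp [clearedSum, map_sum, map_clearedFactor]

/-- `clearedSum` as a polynomial in the parameter. -/
noncomputable def clearedPoly (q : R) (β : ℕ → R) (n : ℕ) : R[X] :=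
  clearedSum (C q) X (C ∘ β) n

theorem eval_clearedPoly (q a : R) (β : ℕ → R) (n : ℕ) :
    (clearedPoly q β n).eval a = clearedSum q a β n := by
  rw [clearedPoly, ← coe_evalRingHom, map_clearedSum]
  congr 1
  · simp
  · simp
  · ext; simp

theorem map_clearedPoly {S : Type*} [CommRing S] (f : R →+* S) (q : R) (β : ℕ → R) (n : ℕ) :
    (clearedPoly q β n).map f = clearedPoly (f q) (f ∘ β) n := by
  rw [clearedPoly, clearedPoly, ← coe_mapRingHom, map_clearedSum]
  congr 1
  · simp
  · simp
  · ext; simp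

theorem natDegree_prod_range_le (f : ℕ → R[X]) (s : Finset ℕ) (h : ∀ i, (f i).natDegree ≤ 2) :
    (∏ i ∈ s, f i).natDegree ≤ 2 * s.card := by
  refine (natDegree_prod_le _ _).trans ((Finset.sum_le_card_nsmul _ _ 2 fun i _ => h i).trans ?_)
  simp [mul_comm]

theorem natDegree_clearedPoly_le (q : R) (β : ℕ → R) (n : ℕ) :
    (clearedPoly q β n).natDegree ≤ 2 * (n - 1) := by
  have hf : ∀ i, ((1 - X * C q ^ i) * (X - C q ^ i) : R[X]).natDegree ≤ 2 := by
    intro i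
    rw [← C_pow]
    compute_degree
  rw [clearedPoly, clearedSum]
  refine natDegree_sum_le_of_forall_le _ _ fun k hk => ?_
  rw [Finset.mem_range] at hk
  rw [Function.comp_apply, ← C_pow, ← C_pow, ← C_1, ← C_sub, ← C_mul, ← C_mul]
  refine natDegree_mul_C_le _ _ |>.trans (natDegree_mul_le.trans ?_)
  have h1 := natDegree_prod_range_le (fun j => ((1 - X * C q ^ (2 * j + 1)) *
    (X - C q ^ (2 * j + 1)) : R[X])) (Finset.range k) fun i => hf _
  have h2 := natDegree_prod_range_le (fun j => ((1 - X * C q ^ (6 * j + 6)) *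
    (X - C q ^ (6 * j + 6)) : R[X])) (Finset.Ico k (n - 1)) fun i => hf _
  rw [Finset.card_range] at h1
  rw [Nat.card_Ico] at h2
  omega

end Cleared

section RootOfUnity

variable {K : Type*} [Field K]

theorem clearedSum_eq {q a : K} (β : ℕ → K) (n : ℕ)
    (h1 : ∀ j < n, 1 - a * q ^ (6 * j + 6) ≠ 0) (h2 : ∀ j < n, a - q ^ (6 * j + 6) ≠ 0) :
    clearedSum q a β (n + 1) = commonDenom q a n * ∑ k ∈ Finset.range (n + 1), paramTerm q a β k := by
  rw [clearedSum, Finset.mul_sum]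
  refine Finset.sum_congr rfl fun k hk => ?_
  rw [Finset.mem_range, Nat.lt_succ_iff] at hk
  rw [paramTerm, ← mul_assoc (commonDenom q a n), clearedFactor, paramRatio, Finset.prod_div_distrib, commonDenom,
    Nat.add_sub_cancel, ← Finset.prod_range_mul_prod_Ico _ hk]
  congr 1
  have : ∏ j ∈ Finset.range k, ((1 - a * q ^ (6 * j + 6)) * (a - q ^ (6 * j + 6))) ≠ 0 := by
    refine Finset.prod_ne_zero_iff.2 fun j hj => ?_
    rw [Finset.mem_range] at hj
    exact mul_ne_zero (h1 j (by omega)) (h2 j (by omega))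
  field_simp

theorem commonDenom_shift {ζ a : K} {n : ℕ} (hζ : ζ ^ (n + 1) = 1) :
    commonDenom ζ (a * ζ ^ 6) n * (1 - a * ζ ^ 6) ^ 2 = commonDenom ζ a n * (1 - a) ^ 2 := by
  have e1 := prod_shift_den ζ a n
  have e2 := prod_shift_den' ζ a n
  have e3 : ζ ^ (6 * n + 6) = 1 := by rw [← mul_add_one, mul_comm, pow_mul, hζ, one_pow]
  have e4 : ζ ^ (6 * n) * ζ ^ 6 = 1 := by rw [← pow_add, e3]
  rw [e3, mul_one] at e1
  simp only [commonDenom, Finset.prod_mul_distrib]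
  generalize (∏ j ∈ Finset.range n, (1 - a * ζ ^ 6 * ζ ^ (6 * j + 6))) = A at *
  generalize (∏ j ∈ Finset.range n, (1 - a * ζ ^ (6 * j + 6))) = B at *
  generalize (∏ j ∈ Finset.range n, (a * ζ ^ 6 - ζ ^ (6 * j + 6))) = A' at *
  generalize (∏ j ∈ Finset.range n, (a - ζ ^ (6 * j + 6))) = B' at *
  have e5 : A' * (1 - a * ζ ^ 6) = B' * (1 - a) := by
    linear_combination (-ζ ^ 6) * e2 + (-A' - (a - 1) * B') * e4
  linear_combination A' * (1 - a * ζ ^ 6) * e1 + B * (1 - a) * e5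

theorem clearedSum_shift {ζ a : K} {n : ℕ} {β : ℕ → K} (hζ : ζ ^ (n + 1) = 1)
    (hβ : ∀ m, β (m + 1) * (1 - ζ ^ (2 * m + 2)) = β m * (1 - ζ ^ (2 * m + 1)))
    (ha : a ^ (n + 1) ≠ 1) :
    clearedSum ζ (a * ζ ^ 6) β (n + 1) * (1 - a * ζ ^ 6) * ζ ^ 3 =
      clearedSum ζ a β (n + 1) * (1 - a) := by
  have hζ0 : ζ ≠ 0 := fun h => by simp [h] at hζ
  have p1 : ∀ i, (ζ ^ i) ^ (n + 1) = 1 := fun i => by rw [← pow_mul, mul_comm, pow_mul, hζ, one_pow]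
  have n1 : ∀ i, 1 - a * ζ ^ i ≠ 0 := fun i h => ha <| by
    have := congrArg (· ^ (n + 1)) (sub_eq_zero.1 h)
    simpa [mul_pow, p1] using this.symm
  have n2 : ∀ i, a - ζ ^ i ≠ 0 := fun i h => ha <| by rw [sub_eq_zero.1 h, p1]
  have n3 : ∀ i, a * ζ ^ 6 - ζ ^ (6 * i + 6) ≠ 0 := fun i => by
    rw [pow_add, ← sub_mul]
    exact mul_ne_zero (n2 _) (pow_ne_zero _ hζ0)
  have n4 : ∀ i, 1 - a * ζ ^ 6 * ζ ^ (6 * i + 6) ≠ 0 := fun i => by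
    rw [mul_assoc, ← pow_add]
    exact n1 _
  have hT := sum_paramTerm_shift hζ0 hβ (fun j => n1 _) (fun j => n2 _)
    (mul_ne_zero (mul_ne_zero (by simpa using n1 1) (n1 3)) (n1 5)) (M := n + 1) (by
      rw [wzCertificate, mul_comm 4 (n + 1), pow_mul ζ (n + 1) 4, hζ]; simp)
  have hD := commonDenom_shift (a := a) hζ
  rw [clearedSum_eq β n (fun j _ => n1 _) (fun j _ => n2 _),
    clearedSum_eq β n (fun j _ => n4 _) (fun j _ => n3 _)]
  have u : (1 - a) * (1 - a * ζ ^ 6) ≠ 0 := mul_ne_zero (by simpa using n1 0) (n1 6)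
  refine mul_right_cancel₀ u ?_
  linear_combination (commonDenom ζ (a * ζ ^ 6) n * (1 - a * ζ ^ 6) ^ 2) * hT +
    (∑ k ∈ Finset.range (n + 1), paramTerm ζ a β k) * (1 - a * ζ ^ 6) * hD

theorem clearedPoly_eq_zero [CharZero K] {ζ : K} {h : ℕ} {β : ℕ → K}
    (hζ : IsPrimitiveRoot ζ (2 * h + 1)) (h3 : ¬ 3 ∣ 2 * h + 1)
    (hβ : ∀ m, β (m + 1) * (1 - ζ ^ (2 * m + 2)) = β m * (1 - ζ ^ (2 * m + 1)))
    (h1 : clearedSum ζ 1 β (2 * h + 1) = 0) : clearedPoly ζ β (2 * h + 1) = 0 := by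
  set A := clearedPoly ζ β (2 * h + 1) with hA
  have hdeg : A.natDegree ≤ 2 * (2 * h) := natDegree_clearedPoly_le _ _ _
  set B : K[X] := A * (1 - X) with hB
  have hBdeg : B.natDegree ≤ 4 * h + 1 := by
    refine natDegree_mul_le.trans ?_
    have : (1 - X : K[X]).natDegree ≤ 1 := by compute_degree
    omega
  have hcomp : B.comp (C (ζ ^ 6) * X) * C (ζ ^ 3) = B := by
    have hne : (X ^ (2 * h + 1) - 1 : K[X]) ≠ 0 := X_pow_sub_C_ne_zero (by omega) 1
    refine mul_right_cancel₀ hne (Polynomial.funext fun a => ?_)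
    by_cases ha : a ^ (2 * h + 1) = 1
    · simp [ha]
    · have := clearedSum_shift hζ.pow_eq_one hβ ha
      simp only [hB, hA, eval_mul, eval_comp, eval_C, eval_X, eval_sub, eval_one,
        eval_clearedPoly, mul_comm (ζ ^ 6) a, this]
  have hcoeff : ∀ i, B.coeff i ≠ 0 → i = h ∨ i = h + (2 * h + 1) := by
    intro i hi
    have hle := (le_natDegree_of_ne_zero hi).trans hBdeg
    have e := congrArg (coeff · i) hcomp
    simp only [coeff_mul_C, comp_C_mul_X_coeff] at e
    have e' : ζ ^ (6 * i + 3) = 1 := by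
      refine mul_left_cancel₀ hi ?_
      rw [mul_one, pow_add, pow_mul, ← mul_assoc, e]
    have hd := (hζ.pow_eq_one_iff_dvd _).1 e'
    have hc : (2 * h + 1).Coprime 3 := ((Nat.Prime.coprime_iff_not_dvd Nat.prime_three).2 h3).symm
    have hd' : 2 * h + 1 ∣ 2 * i + 1 :=
      hc.dvd_of_dvd_mul_left (by rwa [show 3 * (2 * i + 1) = 6 * i + 3 by ring])
    obtain ⟨c, hc⟩ := hd'
    have hc3 : c < 4 := by
      by_contra hcon
      have := Nat.mul_le_mul_left (2 * h + 1) (not_lt.1 hcon)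
      omega
    interval_cases c <;> omega
  have hBeq : B = C (B.coeff h) * X ^ h + C (B.coeff (h + (2 * h + 1))) * X ^ (h + (2 * h + 1)) := by
    ext i
    simp only [coeff_add, coeff_C_mul, coeff_X_pow]
    by_cases hi : B.coeff i = 0
    · rw [hi]
      split_ifs with h4 h5 h5
      · omega
      · subst h4; simp [hi]
      · subst h5; simp [hi]
      · simp
    · rcases hcoeff i hi with rfl | rfl
      · simp
      · simp
  have d0 : B.eval 1 = 0 := by simp [hB]
  have d1 : (derivative B).eval 1 = 0 := by
    simp [hB, hA, derivative_mul, eval_clearedPoly, h1]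
  rw [hBeq] at d0 d1
  simp [derivative_X_pow] at d0 d1
  have hn : ((2 * h + 1 : ℕ) : K) ≠ 0 := Nat.cast_ne_zero.2 (by omega)
  have c2 : B.coeff (h + (2 * h + 1)) = 0 := by
    have : B.coeff (h + (2 * h + 1)) * ((2 * h + 1 : ℕ) : K) = 0 := by
      push_cast
      linear_combination d1 - h * d0
    exact (mul_eq_zero.1 this).resolve_right hn
  have c1 : B.coeff h = 0 := by rw [c2, add_zero] at d0; exact d0
  have hB0 : B = 0 := by rw [hBeq, c1, c2]; simp
  have hX : (1 - X : K[X]) ≠ 0 := by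
    intro h0
    have := congrArg (eval 0) h0
    simp at this
  exact (mul_eq_zero.1 hB0).resolve_right hX

end RootOfUnity

/-- A local ring of `ℤ(q)` at the cyclotomic polynomial `Φ_n`, together with the evaluation at a
primitive `n`-th root of unity. -/
structure CyclotomicLocalization (n : ℕ) (O : Type*) [CommRing O] where
  /-- The evaluation at a primitive `n`-th root of unity. -/
  ev : O →+* ℂ
  /-- The embedding into the field of rational functions. -/
  emb : O →+* RatFunc ℤ
  /-- The variable. -/
  q : O
  emb_injective : Function.Injective emb
  emb_q : emb q = RatFunc.X
  isPrimitiveRoot : IsPrimitiveRoot (ev q) n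
  isUnit_of_ev_ne_zero : ∀ x, ev x ≠ 0 → IsUnit x
  dvd_of_ev_eq_zero : ∀ x, ev x = 0 → aeval q (cyclotomic n ℤ) ∣ x
  exists_eq_div : ∀ x, ∃ p s : ℤ[X], ¬ cyclotomic n ℤ ∣ s ∧
    emb x = algebraMap ℤ[X] (RatFunc ℤ) p / algebraMap ℤ[X] (RatFunc ℤ) s

section Existence

theorem IsPrimitiveRoot.eval₂_eq_zero_iff {ζ : ℂ} {n : ℕ} (hn : 0 < n) (hζ : IsPrimitiveRoot ζ n)
    (p : ℤ[X]) : eval₂RingHom (Int.castRingHom ℂ) ζ p = 0 ↔ cyclotomic n ℤ ∣ p := by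
  rw [cyclotomic_eq_minpoly hζ hn]
  exact minpoly.isIntegrallyClosed_dvd_iff (hζ.isIntegral hn) p

theorem exists_cyclotomicLocalization {n : ℕ} (hn : 0 < n) :
    ∃ (O : Type) (_ : CommRing O), Nonempty (CyclotomicLocalization n O) := by
  obtain ⟨ζ, hζ⟩ : ∃ ζ : ℂ, IsPrimitiveRoot ζ n := ⟨_, Complex.isPrimitiveRoot_exp n hn.ne'⟩
  let g : ℤ[X] →+* ℂ := eval₂RingHom (Int.castRingHom ℂ) ζ
  have hg : ∀ p, g p = 0 ↔ cyclotomic n ℤ ∣ p := hζ.eval₂_eq_zero_iff hn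
  let P : Ideal ℤ[X] := RingHom.ker g
  have hP : P.IsPrime := RingHom.ker_isPrime g
  have hcompl : ∀ s : P.primeCompl, g s ≠ 0 := fun s hs => s.2 hs
  have hle : P.primeCompl ≤ nonZeroDivisors ℤ[X] := Ideal.primeCompl_le_nonZeroDivisors P
  let O := Localization.AtPrime P
  let ev : O →+* ℂ := IsLocalization.lift (M := P.primeCompl) (g := g)
    fun s => (hcompl s).isUnit
  let emb : O →+* RatFunc ℤ := IsLocalization.lift (M := P.primeCompl)
    (g := algebraMap ℤ[X] (RatFunc ℤ)) fun s =>
      (IsFractionRing.to_map_ne_zero_of_mem_nonZeroDivisors (hle s.2)).isUnit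
  have hev : ∀ p, ev (algebraMap ℤ[X] O p) = g p := fun p => IsLocalization.lift_eq _ p
  have hemb : ∀ p, emb (algebraMap ℤ[X] O p) = algebraMap ℤ[X] (RatFunc ℤ) p :=
    fun p => IsLocalization.lift_eq _ p
  refine ⟨O, inferInstance, ⟨⟨ev, emb, algebraMap ℤ[X] O X, ?_, ?_, ?_, ?_, ?_, ?_⟩⟩⟩
  · rw [IsLocalization.lift_injective_iff]
    intro x y
    rw [(IsLocalization.injective O hle).eq_iff,
      (IsFractionRing.injective ℤ[X] (RatFunc ℤ)).eq_iff]
  · rw [hemb, RatFunc.algebraMap_X]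
  · rw [hev]
    simpa [g] using hζ
  · intro x hx
    obtain ⟨p, s, rfl⟩ := IsLocalization.exists_mk'_eq P.primeCompl x
    have hp : p ∈ P.primeCompl := fun hp => hx <| by
      have : g p = 0 := hp
      rw [IsLocalization.lift_mk', this, zero_mul]
    rw [IsLocalization.mk'_eq_mul_mk'_one]
    refine (IsLocalization.map_units O ⟨p, hp⟩).mul ?_
    exact IsUnit.of_mul_eq_one (algebraMap _ _ (s : ℤ[X])) (by
      rw [mul_comm, ← IsLocalization.mk'_eq_mul_mk'_one, IsLocalization.mk'_self])
  · intro x hx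
    obtain ⟨p, s, rfl⟩ := IsLocalization.exists_mk'_eq P.primeCompl x
    have hp : g p = 0 := by
      have h : ev (IsLocalization.mk' O p s) * ev (algebraMap ℤ[X] O s) = 0 := by
        rw [hx, zero_mul]
      rwa [← map_mul, IsLocalization.mk'_spec, hev] at h
    rw [IsLocalization.mk'_eq_mul_mk'_one, aeval_algebraMap_apply, aeval_X_left_apply]
    exact Dvd.dvd.mul_right (_root_.map_dvd _ ((hg p).1 hp)) _
  · intro x
    obtain ⟨p, s, rfl⟩ := IsLocalization.exists_mk'_eq P.primeCompl x
    refine ⟨p, s, fun h => hcompl s ((hg _).2 h), ?_⟩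
    rw [eq_div_iff (IsFractionRing.to_map_ne_zero_of_mem_nonZeroDivisors (hle s.2)), ← hemb,
      ← map_mul, IsLocalization.mk'_spec, hemb]

end Existence

theorem RatFunc.X_ne_zero_int : (RatFunc.X : RatFunc ℤ) ≠ 0 := by
  rw [← RatFunc.algebraMap_X, ← map_zero (algebraMap ℤ[X] (RatFunc ℤ)),
    (IsFractionRing.injective ℤ[X] (RatFunc ℤ)).ne_iff]
  exact Polynomial.X_ne_zero

theorem RatFunc.X_pow_ne_one (i : ℕ) (hi : 0 < i) : (RatFunc.X : RatFunc ℤ) ^ i ≠ 1 := by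
  rw [← RatFunc.algebraMap_X, ← map_pow, ← map_one (algebraMap ℤ[X] (RatFunc ℤ)),
    (IsFractionRing.injective ℤ[X] (RatFunc ℤ)).ne_iff]
  intro h
  have := congrArg natDegree h
  simp at this
  omega

section Binomial

variable {R : Type*} [CommRing R]

theorem prod_one_sub_pow_dvd (q : R) (k l : ℕ) :
    (∏ j ∈ Finset.range k, (1 - q ^ (j + 1))) * (∏ j ∈ Finset.range l, (1 - q ^ (j + 1))) ∣
      ∏ j ∈ Finset.range (k + l), (1 - q ^ (j + 1)) := by
  induction k generalizing l with
  | zero => simp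
  | succ k ihk =>
    induction l with
    | zero => simp
    | succ l ihl =>
      rw [show k + 1 + (l + 1) = k + 1 + l + 1 by ring, Finset.prod_range_succ _ (k + 1 + l),
        show 1 - q ^ (k + 1 + l + 1) = q ^ (k + 1) * (1 - q ^ (l + 1)) + (1 - q ^ (k + 1)) by ring,
        mul_add]
      refine dvd_add ?_ ?_
      · rw [Finset.prod_range_succ _ l]
        obtain ⟨c, hc⟩ := ihl
        exact ⟨c * q ^ (k + 1), by rw [hc]; ring⟩
      · rw [Finset.prod_range_succ _ k, show k + 1 + l = k + (l + 1) by ring]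
        obtain ⟨c, hc⟩ := ihk (l + 1)
        exact ⟨c, by rw [hc]; ring⟩

theorem prod_range_two_mul_one_sub_pow (q : R) (m : ℕ) :
    ∏ j ∈ Finset.range (2 * m), (1 - q ^ (j + 1)) =
      (∏ j ∈ Finset.range m, (1 - q ^ (2 * j + 1))) *
        ∏ j ∈ Finset.range m, (1 - q ^ (2 * j + 2)) := by
  induction m with
  | zero => simp
  | succ m ih =>
    rw [show 2 * (m + 1) = 2 * m + 1 + 1 by ring]
    simp only [Finset.prod_range_succ, ih]
    ring

end Binomial

namespace CyclotomicLocalization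

theorem isDomain {n : ℕ} {O : Type*} [CommRing O] (L : CyclotomicLocalization n O) :
    IsDomain O := L.emb_injective.isDomain L.emb

variable {n : ℕ} {O : Type*} [CommRing O] (L : CyclotomicLocalization n O)

theorem exists_emb_eq_pochRatio (hn : Odd n) (m : ℕ) :
    ∃ x, L.emb x = pochRatio RatFunc.X m := by
  have := L.isDomain
  obtain ⟨c, hc⟩ := prod_one_sub_pow_dvd L.q m m
  rw [← two_mul, prod_range_two_mul_one_sub_pow] at hc
  have hE : ∏ j ∈ Finset.range m, (1 - L.q ^ (2 * j + 2)) =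
      (∏ j ∈ Finset.range m, (1 - L.q ^ (j + 1))) * ∏ j ∈ Finset.range m, (1 + L.q ^ (j + 1)) := by
    rw [← Finset.prod_mul_distrib]
    exact Finset.prod_congr rfl fun j _ => by ring
  have hW : IsUnit (∏ j ∈ Finset.range m, (1 + L.q ^ (j + 1))) := by
    refine L.isUnit_of_ev_ne_zero _ ?_
    rw [map_prod]
    refine Finset.prod_ne_zero_iff.2 fun j _ h => ?_
    have h1 : L.ev L.q ^ (j + 1) = -1 := by
      rw [map_add, map_one, map_pow] at h
      exact (neg_eq_of_add_eq_zero_right h).symm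
    have h2 := congrArg (· ^ n) h1
    simp only [← pow_mul, mul_comm (j + 1) n, hn.neg_one_pow] at h2
    rw [pow_mul, L.isPrimitiveRoot.pow_eq_one, one_pow] at h2
    norm_num at h2
  have hE0 : ∀ j, (1 - RatFunc.X ^ (2 * j + 2) : RatFunc ℤ) ≠ 0 := fun j =>
    sub_ne_zero.2 (RatFunc.X_pow_ne_one _ (by omega)).symm
  obtain ⟨W, hW⟩ := hW
  refine ⟨c * ↑(W⁻¹) ^ 2, ?_⟩
  have hE1 : ∏ j ∈ Finset.range m, (1 - RatFunc.X ^ (2 * j + 2) : RatFunc ℤ) ≠ 0 :=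
    Finset.prod_ne_zero_iff.2 fun j _ => hE0 j
  rw [pochRatio, Finset.prod_div_distrib, eq_div_iff hE1]
  have e1 : ∏ j ∈ Finset.range m, (1 - RatFunc.X ^ (2 * j + 2) : RatFunc ℤ) =
      L.emb (∏ j ∈ Finset.range m, (1 - L.q ^ (2 * j + 2))) := by simp [L.emb_q]
  have e2 : ∏ j ∈ Finset.range m, (1 - RatFunc.X ^ (2 * j + 1) : RatFunc ℤ) =
      L.emb (∏ j ∈ Finset.range m, (1 - L.q ^ (2 * j + 1))) := by simp [L.emb_q]
  have e3 : ∏ j ∈ Finset.range m, (1 - L.q ^ (2 * j + 2)) ≠ 0 := fun h => hE1 (by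
    rw [e1, h, map_zero])
  rw [e1, e2, ← map_mul]
  congr 1
  refine mul_right_cancel₀ e3 ?_
  rw [hc, hE, ← hW]
  have e4 : (↑W⁻¹ : O) * W = 1 := W.inv_mul
  linear_combination (c * (∏ j ∈ Finset.range m, (1 - L.q ^ (j + 1))) ^ 2 * (↑W⁻¹ * W + 1)) * e4

/-- `(q;q²)_m / (q²;q²)_m` as an element of the local ring. -/
noncomputable def ratio (hn : Odd n) (m : ℕ) : O := (L.exists_emb_eq_pochRatio hn m).choose

theorem emb_ratio (hn : Odd n) (m : ℕ) : L.emb (L.ratio hn m) = pochRatio RatFunc.X m :=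
  (L.exists_emb_eq_pochRatio hn m).choose_spec

theorem ratio_succ (hn : Odd n) (m : ℕ) :
    L.ratio hn (m + 1) * (1 - L.q ^ (2 * m + 2)) = L.ratio hn m * (1 - L.q ^ (2 * m + 1)) := by
  apply L.emb_injective
  simp only [map_mul, map_sub, map_one, map_pow, emb_ratio, emb_q]
  exact pochRatio_succ RatFunc.X_pow_ne_one m

theorem ev_ratio_succ (hn : Odd n) (m : ℕ) :
    L.ev (L.ratio hn (m + 1)) * (1 - L.ev L.q ^ (2 * m + 2)) =
      L.ev (L.ratio hn m) * (1 - L.ev L.q ^ (2 * m + 1)) := by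
  simpa using congrArg L.ev (L.ratio_succ hn m)

end CyclotomicLocalization

section Symmetry

variable {R : Type*} [CommRing R]

theorem prod_inv_param {y y' : R} (hy : y * y' = 1) (f : ℕ → R) (s : Finset ℕ) :
    ∏ j ∈ s, ((1 - y' * f j) * (y' - f j)) =
      y' ^ (2 * s.card) * ∏ j ∈ s, ((1 - y * f j) * (y - f j)) := by
  rw [pow_mul, ← Finset.prod_const, ← Finset.prod_mul_distrib]
  refine Finset.prod_congr rfl fun j _ => ?_
  linear_combination (f j * (1 + y * y') - y' - y' * f j ^ 2) * hy

theorem clearedFactor_inv_param {q y y' : R} (hy : y * y' = 1) {L k : ℕ} (hk : k ≤ L) :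
    clearedFactor q y' L k = y' ^ (2 * L) * clearedFactor q y L k := by
  rw [clearedFactor, clearedFactor, prod_inv_param hy, prod_inv_param hy, Finset.card_range,
    Nat.card_Ico]
  obtain ⟨d, rfl⟩ := Nat.exists_eq_add_of_le hk
  rw [Nat.add_sub_cancel_left, mul_add, pow_add]
  ring

theorem clearedSum_inv_param {q y y' : R} (hy : y * y' = 1) (β : ℕ → R) (n : ℕ) :
    clearedSum q y' β n = y' ^ (2 * (n - 1)) * clearedSum q y β n := by
  rw [clearedSum, clearedSum, Finset.mul_sum]
  refine Finset.sum_congr rfl fun k hk => ?_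
  rw [Finset.mem_range] at hk
  rw [clearedFactor_inv_param hy (by omega), mul_assoc]

theorem commonDenom_inv_param {q y y' : R} (hy : y * y' = 1) (L : ℕ) :
    commonDenom q y' L = y' ^ (2 * L) * commonDenom q y L := by
  rw [commonDenom, commonDenom, prod_inv_param hy, Finset.card_range]

/-- The difference of the two sides of the parametric congruence, with denominators cleared. -/
noncomputable def clearedDiff (q : R) (β : ℕ → R) (h : ℕ) (χ : ℤ) : R[X] :=
  C (q ^ h) * clearedPoly q β (2 * h + 1) -
    C ((1 - q ^ (2 * h + 1)) * χ) * commonDenom (C q) X (2 * h)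

theorem eval_clearedDiff (q : R) (β : ℕ → R) (h : ℕ) (χ : ℤ) (a : R) :
    (clearedDiff q β h χ).eval a = q ^ h * clearedSum q a β (2 * h + 1) -
      (1 - q ^ (2 * h + 1)) * χ * commonDenom q a (2 * h) := by
  have : eval a (commonDenom (C q) X (2 * h)) = commonDenom q a (2 * h) := by
    rw [← coe_evalRingHom, map_commonDenom]
    simp
  rw [clearedDiff, eval_sub, eval_mul, eval_mul, eval_C, eval_C, eval_clearedPoly, this]

theorem eval_inv_clearedDiff {q y y' : R} (hy : y * y' = 1) (β : ℕ → R) (h : ℕ) (χ : ℤ) :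
    (clearedDiff q β h χ).eval y' = y' ^ (2 * (2 * h)) * (clearedDiff q β h χ).eval y := by
  rw [eval_clearedDiff, eval_clearedDiff, clearedSum_inv_param hy, commonDenom_inv_param hy,
    Nat.add_sub_cancel]
  ring

end Symmetry

namespace CyclotomicLocalization

variable {O : Type*} [CommRing O]

/-- The image of `Φ_n` in the local ring. -/
noncomputable def cyc {n : ℕ} (L : CyclotomicLocalization n O) : O := aeval L.q (cyclotomic n ℤ)

theorem emb_cyc {n : ℕ} (L : CyclotomicLocalization n O) :
    L.emb L.cyc = algebraMap ℤ[X] (RatFunc ℤ) (cyclotomic n ℤ) := by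
  have : L.emb.comp (aeval (R := ℤ) L.q).toRingHom = algebraMap ℤ[X] (RatFunc ℤ) := by
    ext
    · simp
    · change L.emb (aeval L.q X) = _
      rw [aeval_X, L.emb_q, RatFunc.algebraMap_X]
  exact congrArg (· (cyclotomic n ℤ)) (congrArg DFunLike.coe this)

theorem isUnit_q {n : ℕ} (hn : 0 < n) (L : CyclotomicLocalization n O) : IsUnit L.q :=
  L.isUnit_of_ev_ne_zero _ (L.isPrimitiveRoot.ne_zero hn.ne')

theorem q_pow_ne_one {n : ℕ} (L : CyclotomicLocalization n O) {i : ℕ} (hi : 0 < i) :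
    L.q ^ i ≠ 1 := fun h => RatFunc.X_pow_ne_one i hi (by
  rw [← L.emb_q, ← map_pow, h, map_one])

variable {h : ℕ} (L : CyclotomicLocalization (2 * h + 1) O)

theorem eval_clearedDiff_pow (hh : (2 * h + 1).Coprime 6) :
    (clearedDiff L.q (L.ratio (odd_two_mul_add_one h)) h (jacobiSym (-3) (2 * h + 1))).eval
      (L.q ^ (2 * h + 1)) = 0 := by
  have hX := RatFunc.X_ne_zero_int
  have hT := sum_paramTerm_pow hX RatFunc.X_pow_ne_one hh (M := 2 * h + 1) (by omega)
  generalize jacobiSym (-3) (2 * h + 1) = χ at *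
  apply L.emb_injective
  have hβ : L.emb ∘ L.ratio (odd_two_mul_add_one h) = pochRatio RatFunc.X :=
    funext (L.emb_ratio _)
  rw [eval_clearedDiff, map_zero, map_sub, map_mul, map_mul, map_clearedSum, map_commonDenom, hβ]
  simp only [map_mul, map_sub, map_one, map_pow, L.emb_q, map_intCast]
  rw [clearedSum_eq]
  · linear_combination commonDenom RatFunc.X (RatFunc.X ^ (2 * h + 1)) (2 * h) * hT
  · intro j _
    rw [← pow_add]
    exact sub_ne_zero.2 (RatFunc.X_pow_ne_one _ (by omega)).symm
  · intro j _ h0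
    have := pow_injective_of_not_root hX RatFunc.X_pow_ne_one (sub_eq_zero.1 h0)
    omega

theorem clearedSum_ev_one (hh : (2 * h + 1).Coprime 6) :
    clearedSum (L.ev L.q) 1 (L.ev ∘ L.ratio (odd_two_mul_add_one h)) (2 * h + 1) = 0 := by
  have e := congrArg L.ev (L.eval_clearedDiff_pow hh)
  rw [eval_clearedDiff] at e
  simp only [map_mul, map_sub, map_one, map_pow, map_zero, map_clearedSum,
    L.isPrimitiveRoot.pow_eq_one, sub_self, zero_mul, sub_zero] at e
  exact (mul_eq_zero.1 e).resolve_left (pow_ne_zero _ (L.isPrimitiveRoot.ne_zero (by omega)))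

theorem map_ev_clearedDiff (hh : (2 * h + 1).Coprime 6) :
    (clearedDiff L.q (L.ratio (odd_two_mul_add_one h)) h (jacobiSym (-3) (2 * h + 1))).map L.ev
      = 0 := by
  have h3 : ¬ 3 ∣ 2 * h + 1 := fun h => by
    have := Nat.dvd_gcd h (by norm_num : 3 ∣ 6); rw [hh] at this; omega
  have hc : L.ev ((1 - L.q ^ (2 * h + 1)) * (jacobiSym (-3) (2 * h + 1) : ℤ)) = 0 := by
    rw [map_mul, map_sub, map_pow, L.isPrimitiveRoot.pow_eq_one, map_one, sub_self, zero_mul]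
  rw [clearedDiff, Polynomial.map_sub, Polynomial.map_mul, Polynomial.map_mul, map_clearedPoly,
    clearedPoly_eq_zero L.isPrimitiveRoot h3 (L.ev_ratio_succ _) (L.clearedSum_ev_one hh), map_C,
    map_C, hc]
  simp

theorem cyc_pow_three_dvd (hh : (2 * h + 1).Coprime 6) :
    L.cyc ^ 3 ∣ (clearedDiff L.q (L.ratio (odd_two_mul_add_one h)) h
      (jacobiSym (-3) (2 * h + 1))).eval 1 := by
  have := L.isDomain
  set N := clearedDiff L.q (L.ratio (odd_two_mul_add_one h)) h (jacobiSym (-3) (2 * h + 1)) with hN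
  obtain ⟨N', hN'⟩ : C L.cyc ∣ N := by
    rw [C_dvd_iff_dvd_coeff]
    intro i
    refine L.dvd_of_ev_eq_zero _ ?_
    have := congrArg (coeff · i) (L.map_ev_clearedDiff hh)
    simpa only [coeff_map, coeff_zero] using this
  obtain ⟨Q, hQ⟩ := L.isUnit_q (by omega)
  set y := L.q ^ (2 * h + 1) with hy
  set y' : O := (↑Q⁻¹ : O) ^ (2 * h + 1) with hy'
  have hyy : y * y' = 1 := by rw [hy, hy', ← mul_pow, ← hQ, Units.mul_inv, one_pow]
  have e1 : N.eval y = 0 := L.eval_clearedDiff_pow hh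
  have e2 : N.eval y' = 0 := by rw [hN, eval_inv_clearedDiff hyy, ← hN, e1, mul_zero]
  have hne : y ≠ y' := by
    intro he
    rw [← he, hy, ← pow_add] at hyy
    exact L.q_pow_ne_one (by omega) hyy
  by_cases hc : L.cyc = 0
  · rw [hN', hc]; simp
  rw [hN', eval_mul, eval_C, mul_eq_zero, or_iff_right hc] at e1 e2
  obtain ⟨N₁, h₁⟩ := dvd_iff_isRoot.2 e1
  rw [h₁, eval_mul, eval_sub, eval_X, eval_C, mul_eq_zero,
    or_iff_right (sub_ne_zero.2 hne.symm)] at e2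
  obtain ⟨N₂, h₂⟩ := dvd_iff_isRoot.2 e2
  have hζ := L.isPrimitiveRoot.pow_eq_one
  have d1 : L.cyc ∣ 1 - y := L.dvd_of_ev_eq_zero _ (by rw [hy, map_sub, map_pow, hζ]; simp)
  have d2 : L.cyc ∣ 1 - y' := L.dvd_of_ev_eq_zero _ (by
    have := congrArg L.ev hyy
    rw [map_mul, hy, map_pow, hζ, one_mul, map_one] at this
    rw [map_sub, this, map_one, sub_self])
  rw [hN', h₁, h₂]
  simp only [eval_mul, eval_sub, eval_X, eval_C]
  rw [pow_succ', pow_two]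
  exact mul_dvd_mul_left _ (by rw [← mul_assoc]; exact Dvd.dvd.mul_right (mul_dvd_mul d1 d2) _)

end CyclotomicLocalization

section Lucas

variable {K : Type*} [Field K] {ζ : K} {h : ℕ} {γ : ℕ → K}

theorem pochRatio_lucas (hζ : IsPrimitiveRoot ζ (2 * h + 1)) (h0 : γ 0 = 1)
    (hγ : ∀ m, γ (m + 1) * (1 - ζ ^ (2 * m + 2)) = γ m * (1 - ζ ^ (2 * m + 1))) (l r : ℕ)
    (hr : r < 2 * h + 1) : γ ((2 * h + 1) * l + r) = γ ((2 * h + 1) * l) * γ r := by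
  induction r with
  | zero => rw [add_zero, h0, mul_one]
  | succ r ih =>
    have hne : 1 - ζ ^ (2 * r + 2) ≠ 0 := by
      refine sub_ne_zero.2 fun he => ?_
      have hd := (hζ.pow_eq_one_iff_dvd _).1 he.symm
      have hc : (2 * h + 1).Coprime 2 := by simp
      have hd' := hc.dvd_of_dvd_mul_left (by rwa [show 2 * (r + 1) = 2 * r + 2 by ring])
      exact absurd (Nat.le_of_dvd (by omega) hd') (by omega)
    have hp : ∀ i, ζ ^ (2 * ((2 * h + 1) * l + r) + i) = ζ ^ (2 * r + i) := by
      intro i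
      rw [show 2 * ((2 * h + 1) * l + r) + i = (2 * h + 1) * (2 * l) + (2 * r + i) by ring,
        pow_add, pow_mul, hζ.pow_eq_one, one_pow, one_mul]
    have e1 := hγ ((2 * h + 1) * l + r)
    rw [hp, hp, ih (by omega)] at e1
    refine mul_right_cancel₀ hne ?_
    rw [← add_assoc]
    linear_combination e1 - γ ((2 * h + 1) * l) * hγ r

theorem pochRatio_eq_zero (hζ : IsPrimitiveRoot ζ (2 * h + 1))
    (hγ : ∀ m, γ (m + 1) * (1 - ζ ^ (2 * m + 2)) = γ m * (1 - ζ ^ (2 * m + 1))) (r : ℕ)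
    (h1 : h < r) (h2 : r < 2 * h + 1) : γ r = 0 := by
  induction r with
  | zero => omega
  | succ r ih =>
    have hne : 1 - ζ ^ (2 * r + 2) ≠ 0 := by
      refine sub_ne_zero.2 fun he => ?_
      have hd := (hζ.pow_eq_one_iff_dvd _).1 he.symm
      have hc : (2 * h + 1).Coprime 2 := by simp
      have hd' := hc.dvd_of_dvd_mul_left (by rwa [show 2 * (r + 1) = 2 * r + 2 by ring])
      exact absurd (Nat.le_of_dvd (by omega) hd') (by omega)
    refine (mul_eq_zero.1 ((hγ r).trans ?_)).resolve_right hne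
    rcases eq_or_lt_of_le (Nat.lt_succ_iff.1 h1) with rfl | hlt
    · rw [hζ.pow_eq_one, sub_self, mul_zero]
    · rw [ih hlt (by omega), zero_mul]

/-- The summands over a block of length `2h+1` are proportional to those of the first block. -/
theorem sum_blocks_eq_zero (hζ : IsPrimitiveRoot ζ (2 * h + 1)) (h0 : γ 0 = 1)
    (hγ : ∀ m, γ (m + 1) * (1 - ζ ^ (2 * m + 2)) = γ m * (1 - ζ ^ (2 * m + 1))) {σ : ℕ → K}
    (hw : ∀ j, 1 + ζ ^ (2 * j + 2) + ζ ^ (4 * j + 4) ≠ 0)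
    (hσ : ∀ k, σ k * (∏ j ∈ Finset.range k, (1 + ζ ^ (2 * j + 2) + ζ ^ (4 * j + 4))) ^ 2 =
      γ k ^ 2 * (γ (2 * k) * (1 - ζ ^ (8 * k + 1)) * ζ ^ (2 * k ^ 2)))
    (hsum : ∑ k ∈ Finset.range (2 * h + 1), σ k = 0) (e : ℕ) :
    ∑ k ∈ Finset.range ((2 * h + 1) * e), σ k = 0 := by
  set w : ℕ → K := fun k => ∏ j ∈ Finset.range k, (1 + ζ ^ (2 * j + 2) + ζ ^ (4 * j + 4)) with hwdef
  have hw0 : ∀ k, w k ≠ 0 := fun k => Finset.prod_ne_zero_iff.2 fun j _ => hw j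
  have hper : ∀ l i c, ζ ^ (c * ((2 * h + 1) * l) + i) = ζ ^ i := by
    intro l i c
    rw [show c * ((2 * h + 1) * l) + i = (2 * h + 1) * (c * l) + i by ring,
        pow_add, pow_mul, hζ.pow_eq_one, one_pow, one_mul]
  have hwadd : ∀ l r, w ((2 * h + 1) * l + r) = w ((2 * h + 1) * l) * w r := by
    intro l r
    simp only [hwdef]
    rw [Finset.prod_range_add]
    congr 1
    refine Finset.prod_congr rfl fun j _ => ?_
    rw [mul_add, mul_add, add_assoc (2 * _), add_assoc (4 * _), hper, hper]
  have hblock : ∀ l, ∀ r < 2 * h + 1, σ ((2 * h + 1) * l + r) =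
      γ ((2 * h + 1) * l) ^ 2 * γ ((2 * h + 1) * (2 * l)) / w ((2 * h + 1) * l) ^ 2 * σ r := by
    intro l r hr
    have a1 := hσ ((2 * h + 1) * l + r)
    have a2 := hσ r
    change _ * w _ ^ 2 = _ at a1 a2
    rw [hwadd, pochRatio_lucas hζ h0 hγ l r hr] at a1
    rw [div_mul_eq_mul_div, eq_div_iff (pow_ne_zero _ (hw0 _))]
    refine mul_right_cancel₀ (pow_ne_zero 2 (hw0 r)) ?_
    by_cases hrh : r ≤ h
    · have a3 := pochRatio_lucas hζ h0 hγ (2 * l) (2 * r) (by omega)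
      rw [show 2 * ((2 * h + 1) * l + r) = (2 * h + 1) * (2 * l) + 2 * r by ring, a3,
        show 8 * ((2 * h + 1) * l + r) + 1 = 8 * ((2 * h + 1) * l) + (8 * r + 1) by ring, hper,
        show 2 * ((2 * h + 1) * l + r) ^ 2 =
          (2 * ((2 * h + 1) * l) + 4 * r) * ((2 * h + 1) * l) + 2 * r ^ 2 by ring, hper] at a1
      linear_combination a1 - γ ((2 * h + 1) * l) ^ 2 * γ ((2 * h + 1) * (2 * l)) * a2
    · have a3 : γ r = 0 := pochRatio_eq_zero hζ hγ r (by omega) hr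
      rw [a3] at a1 a2
      linear_combination a1 - γ ((2 * h + 1) * l) ^ 2 * γ ((2 * h + 1) * (2 * l)) * a2
  induction e with
  | zero => simp
  | succ e ih =>
    rw [mul_add_one, Finset.sum_range_add, ih, zero_add,
      Finset.sum_congr rfl fun r hr => hblock e r (Finset.mem_range.1 hr), ← Finset.mul_sum, hsum,
      mul_zero]

end Lucas

namespace CyclotomicLocalization

variable {O : Type*} [CommRing O] {h : ℕ} (L : CyclotomicLocalization (2 * h + 1) O)

/-- The quotient `(q⁶;q⁶)_k / (q²;q²)_k`. -/
def cubeQuotient {R : Type*} [CommRing R] (q : R) (k : ℕ) : R :=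
  ∏ j ∈ Finset.range k, (1 + q ^ (2 * j + 2) + q ^ (4 * j + 4))

theorem ev_cube_factor_ne_zero (hh : (2 * h + 1).Coprime 6) (j : ℕ) :
    1 + L.ev L.q ^ (2 * j + 2) + L.ev L.q ^ (4 * j + 4) ≠ 0 := by
  intro h0
  have h1 : L.ev L.q ^ (6 * (j + 1)) = 1 := by
    linear_combination (L.ev L.q ^ (2 * j + 2) - 1) * h0
  have h2 := hh.dvd_of_dvd_mul_left ((L.isPrimitiveRoot.pow_eq_one_iff_dvd _).1 h1)
  obtain ⟨c, hc⟩ := h2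
  rw [show 2 * j + 2 = 2 * (j + 1) by ring, show 4 * j + 4 = 4 * (j + 1) by ring, hc,
    mul_left_comm, pow_mul _ (2 * h + 1), mul_left_comm, pow_mul _ (2 * h + 1),
    L.isPrimitiveRoot.pow_eq_one] at h0
  norm_num at h0

/-- The summand at `a = 1` as an element of the local ring. -/
noncomputable def term (k : ℕ) : O :=
  L.ratio (odd_two_mul_add_one h) k ^ 2 * (L.ratio (odd_two_mul_add_one h) (2 * k) *
    (1 - L.q ^ (8 * k + 1)) * L.q ^ (2 * k ^ 2)) * Ring.inverse (cubeQuotient L.q k) ^ 2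

theorem term_mul (hh : (2 * h + 1).Coprime 6) (k : ℕ) :
    L.term k * cubeQuotient L.q k ^ 2 =
      L.ratio (odd_two_mul_add_one h) k ^ 2 * (L.ratio (odd_two_mul_add_one h) (2 * k) *
        (1 - L.q ^ (8 * k + 1)) * L.q ^ (2 * k ^ 2)) := by
  have hu : IsUnit (cubeQuotient L.q k) := by
    refine L.isUnit_of_ev_ne_zero _ ?_
    rw [cubeQuotient, map_prod]
    refine Finset.prod_ne_zero_iff.2 fun j _ => ?_
    simpa using L.ev_cube_factor_ne_zero hh j
  rw [term, mul_assoc, ← mul_pow, Ring.inverse_mul_cancel _ hu, one_pow, mul_one]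

theorem emb_term (hh : (2 * h + 1).Coprime 6) (k : ℕ) :
    L.emb (L.term k) = paramTerm RatFunc.X 1 (pochRatio RatFunc.X) k := by
  have e := congrArg L.emb (L.term_mul hh k)
  simp only [map_mul, map_sub, map_one, map_pow, L.emb_q, L.emb_ratio, cubeQuotient, map_prod,
    map_add] at e
  have ne : ∀ i, 0 < i → (1 - RatFunc.X ^ i : RatFunc ℤ) ≠ 0 := fun i hi =>
    sub_ne_zero.2 (RatFunc.X_pow_ne_one i hi).symm
  have hc : ∀ j, (1 + RatFunc.X ^ (2 * j + 2) + RatFunc.X ^ (4 * j + 4) : RatFunc ℤ) =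
      (1 - RatFunc.X ^ (6 * j + 6)) / (1 - RatFunc.X ^ (2 * j + 2)) := by
    intro j
    rw [eq_div_iff (ne _ (by omega))]
    ring
  simp only [hc] at e
  have hne : (∏ j ∈ Finset.range k, ((1 - RatFunc.X ^ (6 * j + 6)) /
      (1 - RatFunc.X ^ (2 * j + 2)) : RatFunc ℤ)) ≠ 0 :=
    Finset.prod_ne_zero_iff.2 fun j _ => div_ne_zero (ne _ (by omega)) (ne _ (by omega))
  refine mul_right_cancel₀ (pow_ne_zero 2 hne) (e.trans ?_)
  have hr : paramRatio (RatFunc.X : RatFunc ℤ) 1 k * (∏ j ∈ Finset.range k,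
      ((1 - RatFunc.X ^ (6 * j + 6)) / (1 - RatFunc.X ^ (2 * j + 2)) : RatFunc ℤ)) ^ 2 =
      pochRatio RatFunc.X k ^ 2 := by
    rw [paramRatio, pochRatio, ← Finset.prod_pow, ← Finset.prod_pow, ← Finset.prod_mul_distrib]
    refine Finset.prod_congr rfl fun j _ => ?_
    have n1 := ne (6 * j + 6) (by omega)
    have n2 := ne (2 * j + 2) (by omega)
    rw [one_mul, one_mul]
    field_simp
  rw [paramTerm, ← hr]
  ring

theorem isUnit_commonDenom (hh : (2 * h + 1).Coprime 6) : IsUnit (commonDenom L.q 1 (2 * h)) := by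
  refine L.isUnit_of_ev_ne_zero _ ?_
  rw [commonDenom, map_prod]
  refine Finset.prod_ne_zero_iff.2 fun j hj => ?_
  have : 1 - L.ev L.q ^ (6 * j + 6) ≠ 0 := sub_ne_zero.2 fun he => by
    have h1 := (L.isPrimitiveRoot.pow_eq_one_iff_dvd _).1 he.symm
    rw [show 6 * j + 6 = 6 * (j + 1) by ring] at h1
    have h2 := Nat.le_of_dvd (by omega) (hh.dvd_of_dvd_mul_left h1)
    rw [Finset.mem_range] at hj
    omega
  simpa using this

theorem clearedSum_one (hh : (2 * h + 1).Coprime 6) :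
    clearedSum L.q 1 (L.ratio (odd_two_mul_add_one h)) (2 * h + 1) =
      commonDenom L.q 1 (2 * h) * ∑ k ∈ Finset.range (2 * h + 1), L.term k := by
  apply L.emb_injective
  have hβ : L.emb ∘ L.ratio (odd_two_mul_add_one h) = pochRatio RatFunc.X :=
    funext (L.emb_ratio _)
  rw [map_mul, map_clearedSum, map_commonDenom, map_sum, hβ, L.emb_q, map_one, clearedSum_eq]
  · simp only [L.emb_term hh]
  · intro j _
    rw [one_mul]
    exact sub_ne_zero.2 (RatFunc.X_pow_ne_one _ (by omega)).symm
  · intro j _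
    exact sub_ne_zero.2 (RatFunc.X_pow_ne_one _ (by omega)).symm

theorem cyc_pow_three_dvd_sum (hh : (2 * h + 1).Coprime 6) :
    L.cyc ^ 3 ∣ L.q ^ h * (∑ k ∈ Finset.range (2 * h + 1), L.term k) -
      (1 - L.q ^ (2 * h + 1)) * (jacobiSym (-3) (2 * h + 1) : ℤ) := by
  have hd := L.cyc_pow_three_dvd hh
  rw [eval_clearedDiff, L.clearedSum_one hh] at hd
  rw [← (L.isUnit_commonDenom hh).dvd_mul_left]
  convert hd using 1
  ring

theorem ev_sum_term (hh : (2 * h + 1).Coprime 6) :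
    ∑ k ∈ Finset.range (2 * h + 1), L.ev (L.term k) = 0 := by
  have h1 := L.clearedSum_ev_one hh
  rw [← map_one L.ev, ← map_clearedSum, L.clearedSum_one hh, map_mul, map_sum] at h1
  exact (mul_eq_zero.1 h1).resolve_left ((L.isUnit_commonDenom hh).map L.ev).ne_zero

theorem cyc_dvd_sum (hh : (2 * h + 1).Coprime 6) (e : ℕ) :
    L.cyc ∣ ∑ k ∈ Finset.range ((2 * h + 1) * e), L.term k := by
  refine L.dvd_of_ev_eq_zero _ ?_
  rw [map_sum]
  refine sum_blocks_eq_zero (γ := fun m => L.ev (L.ratio (odd_two_mul_add_one h) m))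
    L.isPrimitiveRoot ?_ (L.ev_ratio_succ _) (L.ev_cube_factor_ne_zero hh) (fun k => ?_)
    (L.ev_sum_term hh) e
  · have : L.ratio (odd_two_mul_add_one h) 0 = 1 := L.emb_injective (by
      rw [L.emb_ratio, map_one, pochRatio, Finset.prod_range_zero])
    simp [this]
  · simpa [cubeQuotient, map_prod] using congrArg L.ev (L.term_mul hh k)

end CyclotomicLocalization

section Terms

theorem qTerm_eq {F : Type*} [Field F] {q : F} (hq1 : ∀ i, 0 < i → q ^ i ≠ 1) (k : ℕ) :
    qTerm q k = paramTerm q 1 (pochRatio q) k / (1 - q) := by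
  have hq : q ≠ 1 := by simpa using hq1 1 one_pos
  have e1 : qPoch (q ^ 2) (q ^ 2) (2 * k) = ∏ j ∈ Finset.range (2 * k), (1 - q ^ (2 * j + 2)) :=
    Finset.prod_congr rfl fun j _ => by ring
  have e2 : qPoch q (q ^ 2) (2 * k) = ∏ j ∈ Finset.range (2 * k), (1 - q ^ (2 * j + 1)) :=
    Finset.prod_congr rfl fun j _ => by ring
  have e3 : qPoch q (q ^ 2) k = ∏ j ∈ Finset.range k, (1 - q ^ (2 * j + 1)) :=
    Finset.prod_congr rfl fun j _ => by ring
  have e4 : qPoch (q ^ 6) (q ^ 6) k = ∏ j ∈ Finset.range k, (1 - q ^ (6 * j + 6)) :=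
    Finset.prod_congr rfl fun j _ => by ring
  have e5 : paramRatio q 1 k = (∏ j ∈ Finset.range k, (1 - q ^ (2 * j + 1))) ^ 2 /
      (∏ j ∈ Finset.range k, (1 - q ^ (6 * j + 6))) ^ 2 := by
    simp only [paramRatio, one_mul, Finset.prod_div_distrib, Finset.prod_mul_distrib, pow_two]
  rw [qTerm, qNumber_eq_div hq, e1, e2, e3, e4, paramTerm, e5, pochRatio, Finset.prod_div_distrib]
  ring

/-- The difference of the two sides of the congruence. -/
theorem sub_eq_div {F : Type*} [Field F] {q : F} (hq : q ≠ 0) (hq1 : ∀ i, 0 < i → q ^ i ≠ 1)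
    (h : ℕ) (χ : F) :
    (∑ k ∈ Finset.range (2 * h + 1), qTerm q k) -
        q ^ (-((((2 * h + 1 : ℕ) : ℤ) - 1) / 2)) * qNumber q (2 * h + 1) * χ =
      (q ^ h * (∑ k ∈ Finset.range (2 * h + 1), paramTerm q 1 (pochRatio q) k) -
        (1 - q ^ (2 * h + 1)) * χ) / (q ^ h * (1 - q)) := by
  have hq' : q ≠ 1 := by simpa using hq1 1 one_pos
  have hne : 1 - q ≠ 0 := sub_ne_zero.2 hq'.symm
  have he : (((2 * h + 1 : ℕ) : ℤ) - 1) / 2 = h := by push_cast; omega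
  have hqh : q ^ h ≠ 0 := pow_ne_zero _ hq
  simp only [qTerm_eq hq1, ← Finset.sum_div, qNumber_eq_div hq', he, zpow_neg, zpow_natCast]
  field_simp

end Terms

section Combination

theorem cyclotomic_prime {n : ℕ} (hn : 0 < n) : Prime (cyclotomic n ℤ) :=
  (cyclotomic.irreducible hn).prime

/-- If `cyc ^ e` divides an element of the local ring at `Φ_d`, then `Φ_d ^ e` divides the
numerator of every fraction representing that element. -/
theorem CyclotomicLocalization.cyclotomic_pow_dvd {d : ℕ} (hd : 0 < d) {O : Type*} [CommRing O]
    (L : CyclotomicLocalization d O) {x : O} {e : ℕ} (hx : L.cyc ^ e ∣ x) {a b : ℤ[X]} (hb : b ≠ 0)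
    (hab : L.emb x = algebraMap ℤ[X] (RatFunc ℤ) a / algebraMap ℤ[X] (RatFunc ℤ) b) :
    cyclotomic d ℤ ^ e ∣ a := by
  obtain ⟨y, rfl⟩ := hx
  obtain ⟨p, s, hs, hy⟩ := L.exists_eq_div y
  have hs0 : s ≠ 0 := fun h => hs (h ▸ dvd_zero _)
  have inj := IsFractionRing.injective ℤ[X] (RatFunc ℤ)
  have hne : ∀ {c : ℤ[X]}, c ≠ 0 → algebraMap ℤ[X] (RatFunc ℤ) c ≠ 0 := fun hc h =>
    hc (inj (by rw [h, map_zero]))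
  rw [map_mul, map_pow, L.emb_cyc, hy, ← mul_div_assoc, div_eq_div_iff (hne hs0) (hne hb),
    ← map_pow, ← map_mul, ← map_mul, ← map_mul] at hab
  have := inj hab
  refine (cyclotomic_prime hd).pow_dvd_of_dvd_mul_right e hs ⟨p * b, ?_⟩
  rw [← this, mul_assoc]

theorem isRelPrime_cyclotomic {m n : ℕ} (hm : 0 < m) (hn : 0 < n) (hmn : m ≠ n) :
    IsRelPrime (cyclotomic m ℤ) (cyclotomic n ℤ) := by
  refine (cyclotomic.irreducible hm).isRelPrime_iff_not_dvd.2 fun hdvd => hmn ?_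
  have ha := (cyclotomic.irreducible hm).associated_of_dvd (cyclotomic.irreducible hn) hdvd
  exact cyclotomic_injective (R := ℤ)
    (eq_of_monic_of_associated (cyclotomic.monic m ℤ) (cyclotomic.monic n ℤ) ha)

theorem qNumber_mul_cyclotomic_sq_dvd {n : ℕ} (hn : 1 < n) {a : ℤ[X]}
    (h1 : ∀ d, 1 < d → d ∣ n → cyclotomic d ℤ ∣ a) (h3 : cyclotomic n ℤ ^ 3 ∣ a) :
    qNumber (X : ℤ[X]) n * cyclotomic n ℤ ^ 2 ∣ a := by
  have hmem : n ∈ n.divisors.erase 1 := by simp; omega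
  rw [qNumber, ← prod_cyclotomic_eq_geom_sum (by omega), ← Finset.mul_prod_erase _ _ hmem,
    mul_right_comm, ← pow_succ']
  refine IsRelPrime.mul_dvd ?_ h3 (Finset.prod_dvd_of_isRelPrime ?_ ?_)
  · refine IsRelPrime.prod_right fun d hd => IsRelPrime.pow_left ?_
    simp only [Finset.mem_erase, Nat.mem_divisors] at hd
    exact isRelPrime_cyclotomic (by omega) (Nat.pos_of_dvd_of_pos hd.2.2.1 (by omega)) hd.1.symm
  · intro d hd e he hde
    simp only [Finset.coe_erase, Set.mem_sdiff, Finset.mem_coe, Nat.mem_divisors] at hd he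
    exact isRelPrime_cyclotomic (Nat.pos_of_dvd_of_pos hd.1.1.1 (by omega))
      (Nat.pos_of_dvd_of_pos he.1.1.1 (by omega)) hde
  · intro d hd
    simp only [Finset.mem_erase, Nat.mem_divisors] at hd
    have := Nat.pos_of_dvd_of_pos hd.2.2.1 (by omega)
    exact h1 d (by omega) hd.2.2.1

end Combination

theorem theorem4 (n : ℕ) (hn : 0 < n) (hn6 : n.Coprime 6) :
    RatCongr (qNumber (X : ℤ[X]) n * cyclotomic n ℤ ^ 2)
      (∑ k ∈ Finset.range n, qTerm (RatFunc.X : RatFunc ℤ) k)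
      ((RatFunc.X : RatFunc ℤ) ^ (-(((n : ℤ) - 1) / 2)) * qNumber (RatFunc.X : RatFunc ℤ) n *
        ((jacobiSym (-3) n : ℤ) : RatFunc ℤ)) := by
  rcases eq_or_lt_of_le (Nat.succ_le_of_lt hn) with rfl | hn1
  · refine ⟨0, 1, one_ne_zero, ?_, dvd_zero _, isRelPrime_one_right⟩
    simp [qTerm, qNumber, qPoch]
  have hodd : ∀ {m : ℕ}, m.Coprime 6 → ∃ i, m = 2 * i + 1 := fun {m} hm => by
    refine ⟨m / 2, ?_⟩
    have h2 : ¬ 2 ∣ m := fun h => by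
      have := Nat.dvd_gcd h (by norm_num : 2 ∣ 6); rw [hm] at this; omega
    omega
  obtain ⟨h, rfl⟩ := hodd hn6
  have hX := RatFunc.X_ne_zero_int
  have hX1 : (1 - RatFunc.X : RatFunc ℤ) ≠ 0 :=
    sub_ne_zero.2 (by simpa using (RatFunc.X_pow_ne_one 1 one_pos).symm)
  rw [RatCongr, sub_eq_div hX RatFunc.X_pow_ne_one]
  set S := ∑ k ∈ Finset.range (2 * h + 1), paramTerm (RatFunc.X : RatFunc ℤ) 1
    (pochRatio RatFunc.X) k with hS
  set f : RatFunc ℤ := (RatFunc.X ^ h * S - (1 - RatFunc.X ^ (2 * h + 1)) *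
    ((jacobiSym (-3) (2 * h + 1) : ℤ) : RatFunc ℤ)) / (RatFunc.X ^ h * (1 - RatFunc.X)) with hf
  obtain ⟨a, b, hab, hfab⟩ := IsFractionRing.exists_reduced_fraction (A := ℤ[X]) f
  have hb0 : (b : ℤ[X]) ≠ 0 := nonZeroDivisors.coe_ne_zero b
  rw [IsFractionRing.mk'_eq_div] at hfab
  have key : qNumber (X : ℤ[X]) (2 * h + 1) * cyclotomic (2 * h + 1) ℤ ^ 2 ∣ a := by
    have local_dvd : ∀ i e, 0 < i → 2 * i + 1 ∣ 2 * h + 1 →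
        (∀ (O : Type) (_ : CommRing O) (L : CyclotomicLocalization (2 * i + 1) O), L.cyc ^ e ∣
          L.q ^ h * (∑ k ∈ Finset.range (2 * h + 1), L.term k) -
            (1 - L.q ^ (2 * h + 1)) * (jacobiSym (-3) (2 * h + 1) : ℤ)) →
        cyclotomic (2 * i + 1) ℤ ^ e ∣ a := by
      intro i e hi hdvd H
      obtain ⟨O, _, ⟨L⟩⟩ := exists_cyclotomicLocalization (n := 2 * i + 1) (by omega)
      have hu : IsUnit (L.q ^ h * (1 - L.q)) := by
        refine ((L.isUnit_q (by omega)).pow h).mul (L.isUnit_of_ev_ne_zero _ ?_)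
        rw [map_sub, map_one, sub_ne_zero]
        exact (L.isPrimitiveRoot.ne_one (by omega)).symm
      obtain ⟨u, hu⟩ := hu
      refine L.cyclotomic_pow_dvd (by omega) (Dvd.dvd.mul_right (H O _ L) ↑u⁻¹) hb0 ?_
      rw [hfab, hf, eq_div_iff (mul_ne_zero (pow_ne_zero _ hX) hX1)]
      have e1 : (RatFunc.X ^ h * (1 - RatFunc.X) : RatFunc ℤ) = L.emb u := by
        rw [hu, map_mul, map_sub, map_pow, L.emb_q, map_one]
      rw [e1, ← map_mul, Units.inv_mul_cancel_right, map_sub, map_mul, map_mul, map_sub, map_pow,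
        map_pow, map_sum, map_one, L.emb_q, map_intCast, hS]
      simp only [L.emb_term (hn6.coprime_dvd_left hdvd)]
    refine qNumber_mul_cyclotomic_sq_dvd hn1 ?_ ?_
    · intro d hd1 hd
      have hd6 := hn6.coprime_dvd_left hd
      obtain ⟨i, rfl⟩ := hodd hd6
      rw [← pow_one (cyclotomic _ ℤ)]
      refine local_dvd i 1 (by omega) hd fun O _ L => ?_
      rw [pow_one]
      obtain ⟨e, he⟩ := hd
      refine dvd_sub (Dvd.dvd.mul_left ?_ _) (Dvd.dvd.mul_right (L.dvd_of_ev_eq_zero _ ?_) _)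
      · rw [he]
        exact L.cyc_dvd_sum hd6 e
      · rw [he, map_sub, map_pow, pow_mul, L.isPrimitiveRoot.pow_eq_one, one_pow, map_one, sub_self]
    · exact local_dvd h 3 (by omega) dvd_rfl fun O _ L => L.cyc_pow_three_dvd_sum hn6
  exact ⟨a, b, hb0, hfab.symm, key, IsRelPrime.of_dvd_left hab key⟩
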